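/- Let $\mathcal H$ be a separable infinite-dimensional complex Hilbert space. Let $\mathcal U(\mathcal H)$ be the set of unitary operators on $\mathcal H$ and $\mathcal B(\mathcal H)_{sa}$ the set of bounded selfadjoint operators on $\mathcal H$, each endowed with the Borel $\sigma$-algebra of the weak operator topology. Two operators $S,T$ in one of these sets are unitarily equivalent if $T=USU^*$ for some $U\in\mathcal U(\mathcal H)$. A CLI group is a Polish group that admits a compatible complete left-invariant metric. An equivalence relation $E$ on $X$ is Borel reducible to an equivalence relation $F$ on $Y$ if there is a Borel map $f:X\to Y$ such that, for all $x,x'\in X$, $x\mathrel E x'$ if and only if $f(x)\mathrel F f(x')$. Theorem. For every CLI group $G$ and every Borel action of $G$ on a standard Borel space $Y$ (that is, an action for which the map $G\times Y\to Y$, $(g,y)\mapsto gy$, is Borel), neither of the following equivalence relations is Borel reducible to the orbit equivalence relation of the action of $G$ on $Y$: 1. unitary equivalence of unitary operators, on $\mathcal U(\mathcal H)$; 2. unitary equivalence of bounded selfadjoint operators, on $\mathcal B(\mathcal H)_{sa}$. -/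

import Mathlib

noncomputable section

/-- A CLI group: a Polish group that admits a complete left-invariant metric
compatible with its topology. -/
class IsCLIGroup (G : Type*) [Group G] [t : TopologicalSpace G] : Prop
    extends IsTopologicalGroup G, PolishSpace G where
  exists_complete_leftInvariant_metric :
    ∃ m : MetricSpace G,
      m.toUniformSpace.toTopologicalSpace = t ∧
      @CompleteSpace G m.toUniformSpace ∧
      ∀ g x y : G, m.dist (g * x) (g * y) = m.dist x y

/-- Borel reducibility of the equivalence relation `E` on `X` to the equivalence
relation `F` on `Y`. -/
def BorelReducible {X Y : Type*} [MeasurableSpace X] [MeasurableSpace Y]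
    (E : Setoid X) (F : Setoid Y) : Prop :=
  ∃ f : X → Y, Measurable f ∧ ∀ x x' : X, E x x' ↔ F (f x) (f x')

section Operators

variable (H : Type*) [NormedAddCommGroup H] [InnerProductSpace ℂ H] [CompleteSpace H]

/-- Unitary equivalence of bounded operators: `T = U S U*` for some unitary `U`. -/
def unitaryEquivalence : Setoid (H →L[ℂ] H) where
  r S T := ∃ U ∈ unitary (H →L[ℂ] H), T = U * S * star U
  iseqv :=
    { refl := fun S => ⟨1, one_mem _, by simp⟩
      symm := by
        rintro S T ⟨U, hU, rfl⟩
        refine ⟨star U, Unitary.star_mem hU, ?_⟩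
        have h : star U * U = 1 := (Unitary.mem_iff.mp hU).1
        calc S = (star U * U) * S * (star U * U) := by simp [h]
          _ = star U * (U * S * star U) * star (star U) := by
            simp only [star_star, mul_assoc]
      trans := by
        rintro S T R ⟨U, hU, rfl⟩ ⟨V, hV, rfl⟩
        exact ⟨V * U, mul_mem hV hU, by simp only [star_mul, mul_assoc]⟩ }

/-- The unitary operators on `H`. This is a type of its own, so that it carries the weak
operator topology and not the norm topology. -/
def UnitaryOperator : Type _ := {T : H →L[ℂ] H // T ∈ unitary (H →L[ℂ] H)}

/-- The bounded selfadjoint operators on `H`, again as a type of its own. -/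
def SelfAdjointOperator : Type _ := {T : H →L[ℂ] H // IsSelfAdjoint T}

variable {H}

/-- The underlying bounded operator of a unitary operator. -/
def UnitaryOperator.toCLM (T : UnitaryOperator H) : H →L[ℂ] H := T.1

/-- The underlying bounded operator of a selfadjoint operator. -/
def SelfAdjointOperator.toCLM (T : SelfAdjointOperator H) : H →L[ℂ] H := T.1

/-- The weak operator topology on the unitary operators. -/
instance : TopologicalSpace (UnitaryOperator H) :=
  TopologicalSpace.induced
    (fun T => (ContinuousLinearMapWOT.ofCLM T.toCLM : H →WOT[ℂ] H)) inferInstance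

/-- The weak operator topology on the bounded selfadjoint operators. -/
instance : TopologicalSpace (SelfAdjointOperator H) :=
  TopologicalSpace.induced
    (fun T => (ContinuousLinearMapWOT.ofCLM T.toCLM : H →WOT[ℂ] H)) inferInstance

instance : MeasurableSpace (UnitaryOperator H) := borel _

instance : BorelSpace (UnitaryOperator H) := ⟨rfl⟩

instance : MeasurableSpace (SelfAdjointOperator H) := borel _

instance : BorelSpace (SelfAdjointOperator H) := ⟨rfl⟩

variable (H)

/-- Unitary equivalence of unitary operators. -/
def unitaryEquivalenceOfUnitary : Setoid (UnitaryOperator H) :=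
  (unitaryEquivalence H).comap UnitaryOperator.toCLM

/-- Unitary equivalence of bounded selfadjoint operators. -/
def unitaryEquivalenceOfSelfAdjoint : Setoid (SelfAdjointOperator H) :=
  (unitaryEquivalence H).comap SelfAdjointOperator.toCLM

end Operators

end

/-!
Diagonal operators reduce the statement to sequences of reals. Fix a Hilbert basis indexed by `ℕ` and
an injective continuous map `φ` from `ℝ` to the unit circle (or to the reals in the unit disc). A
sequence `z : ℕ → ℝ` is sent to the diagonal operator with entries `φ (z i)`, which depends
continuously on `z`. Permuting `z` does not change the operator up to unitary equivalence, and
unitarily equivalent diagonal operators have the same set of eigenvalues. Hence a Borel reduction to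
the orbit equivalence relation of `G` on `Y` yields a Borel map `f : (ℕ → ℝ) → Y` which is constant
up to `G` on the orbits of the group of permutations of `ℕ`, and which separates sequences with
different ranges. For a CLI group `G` there is no such map (`exists_range_ne_of_forall_perm`).

The reason is a Baire category argument, valid for any Polish group `S` acting continuously on a
Polish space `X` and any Borel `f : X → Y` that maps `S`-orbits into `G`-orbits.

* Orbit continuity (`exists_isOpen_forall_residual_smul_mem`): for a neighbourhood `W` of `1` in
  `G`, locally in `x` there is a neighbourhood `N` of `1` in `S` such that
  `f (v • x) ∈ W • f x` for generic `x` and generic `v ∈ N`. It rests on the Baire property of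
  analytic sets and on the Kuratowski-Ulam theorem.
* Passage to the limit (`exists_residual_forall_exists_smul_eq`): let `x` and `z` be generic, and
  suppose that points `y n` of the orbit of `z` converge to `x`, where `y (n + 1) = v n • y n` with
  `v n` so close to `1` that `f (y (n + 1)) ∈ W n • f (y n)`. If the `W n` shrink fast enough,
  completeness of the left-invariant metric shows that `f (y n) = g n • f z` with `g n → g`. For
  generic `h` the Borel map `(x, h) ↦ h • f x` behaves continuously along the sequence
  `(y n, h * g * (g n)⁻¹) → (x, h)`, on which it has the constant value `(h * g) • f z`. Therefore
  `h • f x = (h * g) • f z`, so `f x = g • f z`. This uses no topology on `Y`.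

For permutations acting on sequences, let `z` be generic and let `x` be its subsequence of terms of
even index. Both are generic, and the rearrangements of `z` which agree with `x` on longer and longer
initial segments converge to `x`, each being obtained from the previous one by a permutation that
fixes a long initial segment. So `f x` and `f z` lie in one `G`-orbit although the ranges of `x` and
`z` differ.
-/

open Filter Topology Set MeasureTheory
open scoped InnerProductSpace

/-! ### Baire category in products -/

/-- The Kuratowski-Ulam theorem in filter form: almost all sections of a residual set in a product
are residual. Only the second factor has to be second countable. -/
theorem curry_residual_le_residual_prod (X S : Type*) [TopologicalSpace X] [TopologicalSpace S]
    [SecondCountableTopology S] :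
    (residual X).curry (residual S) ≤ residual (X × S) := by
  have hc : CountableInterFilter ((residual X).curry (residual S)) := by
    refine ⟨fun A hA h => ?_⟩
    have h' : ∀ a ∈ A, ∀ᶠ x in residual X, ∀ᶠ s in residual S, (x, s) ∈ a :=
      fun a ha => eventually_curry_iff.1 (h a ha)
    refine eventually_curry_iff.2 ?_
    filter_upwards [(eventually_countable_ball hA).2 h'] with x hx
    exact ((eventually_countable_ball hA).2 hx).mono fun s hs => mem_sInter.2 hs
  refine le_countableGenerate_iff_of_countableInterFilter.mpr ?_
  rintro U ⟨hU, hd⟩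
  refine eventually_curry_iff.2 ?_
  -- For `V` in a countable basis, almost every section of `U` meets `V`.
  have key : ∀ V ∈ TopologicalSpace.countableBasis S,
      ∀ᶠ x in residual X, ∃ s ∈ V, (x, s) ∈ U := by
    intro V hV
    have hVo := TopologicalSpace.isOpen_of_mem_countableBasis hV
    obtain ⟨s₀, hs₀⟩ := TopologicalSpace.nonempty_of_mem_countableBasis hV
    have heq : {x : X | ∃ s ∈ V, (x, s) ∈ U} = ⋃ s ∈ V, (fun x => (x, s)) ⁻¹' U := by
      ext x; simp
    refine residual_of_dense_open (s := {x : X | ∃ s ∈ V, (x, s) ∈ U}) ?_ ?_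
    · rw [heq]
      exact isOpen_biUnion fun s _ => hU.preimage (by fun_prop)
    · refine dense_iff_inter_open.2 fun O hO ⟨x, hx⟩ => ?_
      obtain ⟨⟨a, b⟩, ⟨ha, hb⟩, hab⟩ :=
        dense_iff_inter_open.1 hd _ (hO.prod hVo) ⟨(x, s₀), hx, hs₀⟩
      exact ⟨a, ha, b, hb, hab⟩
  filter_upwards [(eventually_countable_ball (TopologicalSpace.countable_countableBasis S)).2 key]
    with x hx
  refine residual_of_dense_open (s := {s | (x, s) ∈ U}) (hU.preimage (by fun_prop)) ?_
  exact (TopologicalSpace.isBasis_countableBasis S).dense_iff.2 fun V hV _ =>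
    let ⟨s, hs, h⟩ := hx V hV
    ⟨s, hs, h⟩

theorem Filter.Eventually.residual_prod {X S : Type*} [TopologicalSpace X] [TopologicalSpace S]
    [SecondCountableTopology S] {p : X × S → Prop} (h : ∀ᶠ q in residual (X × S), p q) :
    ∀ᶠ x in residual X, ∀ᶠ s in residual S, p (x, s) :=
  eventually_curry_iff.1 (curry_residual_le_residual_prod X S h)

/-! ### The Baire property of analytic sets -/

/-- Every set has a minimal Baire measurable hull, up to meagre sets; the hull can be taken
inside the closure. -/
theorem exists_baireMeasurableSet_hull {X : Type*} [TopologicalSpace X]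
    [SecondCountableTopology X] (A : Set X) :
    ∃ B : Set X, A ⊆ B ∧ B ⊆ closure A ∧ BaireMeasurableSet B ∧
      ∀ C, BaireMeasurableSet C → A ⊆ C → IsMeagre (B \ C) := by
  -- The hull removes from `closure A` the largest open set in which `A` is meagre, and adds `A`.
  let I := {V ∈ TopologicalSpace.countableBasis X | IsMeagre (A ∩ V)}
  have hI : I.Countable := (TopologicalSpace.countable_countableBasis X).mono (sep_subset _ _)
  have hM : IsMeagre (A ∩ ⋃₀ I) := by
    rw [sUnion_eq_biUnion, inter_iUnion₂]
    exact isMeagre_biUnion hI fun V hV => hV.2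
  have hMo : IsOpen (⋃₀ I) :=
    isOpen_sUnion fun V hV => TopologicalSpace.isOpen_of_mem_countableBasis hV.1
  let B := (closure A \ ⋃₀ I) ∪ (A ∩ ⋃₀ I)
  have hB : BaireMeasurableSet B :=
    (isClosed_closure.isOpen_compl.baireMeasurableSet.of_compl.diff hMo.baireMeasurableSet).union
      hM.baireMeasurableSet
  refine ⟨B, fun x hx => ?_, ?_, hB, fun C hC hAC => ?_⟩
  · by_cases h : x ∈ ⋃₀ I
    · exact Or.inr ⟨hx, h⟩
    · exact Or.inl ⟨subset_closure hx, h⟩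
  · exact union_subset sdiff_subset (inter_subset_left.trans subset_closure)
  · obtain ⟨O, hO, hBO⟩ := (hB.diff hC).residualEq_isOpen
    have hOI : O ⊆ ⋃₀ I := by
      intro x hx
      obtain ⟨V, hV, hxV, hVO⟩ :=
        (TopologicalSpace.isBasis_countableBasis X).exists_subset_of_mem_open hx hO
      refine ⟨V, ⟨hV, ?_⟩, hxV⟩
      filter_upwards [hBO] with y hy hyA
      exact ((iff_of_eq hy).2 (hVO hyA.2)).2 (hAC hyA.1)
    filter_upwards [hBO, hM] with y hy hyM hyB
    have hyO : y ∈ ⋃₀ I := hOI ((iff_of_eq hy).1 hyB)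
    rcases hyB.1 with h | h
    · exact h.2 hyO
    · exact hyM h

/-- Analytic sets have the Baire property. Write the set as the continuous image of `ℕ → ℕ` and take
the hull `B s` of the image of each basic clopen set. Off the meagre set where some `B s` is not
covered by its successors, a point of `B []` determines a branch, whose image is that point. -/
theorem MeasureTheory.AnalyticSet.baireMeasurableSet {X : Type*} [TopologicalSpace X]
    [SecondCountableTopology X] [T3Space X] {A : Set X} (hA : AnalyticSet A) :
    BaireMeasurableSet A := by
  rw [AnalyticSet] at hA
  rcases hA with rfl | ⟨f, hf, rfl⟩
  · exact isOpen_empty.baireMeasurableSet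
  -- `PiNat.res` lists the initial segment in reverse order, so extensions are given by `::`.
  let A : List ℕ → Set X := fun s => f '' {z | PiNat.res z s.length = s}
  choose B hAB hBA hB hmin using fun s => exists_baireMeasurableSet_hull (A s)
  have hmeagre : ∀ s, IsMeagre (B s \ ⋃ n : ℕ, B (n :: s)) := by
    refine fun s => hmin s _ (.iUnion fun n => hB _) ?_
    rintro _ ⟨z, hz, rfl⟩
    refine mem_iUnion.2 ⟨z s.length, hAB _ ⟨z, ?_, rfl⟩⟩
    simpa [PiNat.res_succ] using hz
  have hroot : range f = A [] := by simp [A]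
  rw [hroot]
  refine (hB []).congr ?_
  filter_upwards [eventually_countable_forall.2 hmeagre] with x hx
  refine propext ⟨fun hxB => ?_, fun h => hAB _ h⟩
  have hstep : ∀ s, x ∈ B s → ∃ n : ℕ, x ∈ B (n :: s) := by
    intro s hs
    by_contra hcon
    exact hx s ⟨hs, by simpa using hcon⟩
  choose! nxt hnxt using hstep
  let br : ℕ → List ℕ := fun n => Nat.rec [] (fun _ s => nxt s :: s) n
  have hbr : ∀ n, x ∈ B (br n) := by
    intro n
    induction n with
    | zero => exact hxB
    | succ n ih => exact hnxt _ ih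
  let z : ℕ → ℕ := fun n => nxt (br n)
  have hres : ∀ n, PiNat.res z n = br n := by
    intro n
    induction n with
    | zero => rfl
    | succ n ih => rw [PiNat.res_succ, ih]
  suffices f z = x from ⟨z, by simp, this⟩
  by_contra hne
  obtain ⟨K, hK, hKc, hxK⟩ : ∃ K ∈ 𝓝 (f z), IsClosed K ∧ x ∉ K := by
    obtain ⟨K, hK, hKc, hKx⟩ := exists_mem_nhds_isClosed_subset
      (isOpen_compl_singleton.mem_nhds (show f z ∈ ({x} : Set X)ᶜ from hne))
    exact ⟨K, hK, hKc, fun h => hKx h rfl⟩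
  obtain ⟨n, hn⟩ : ∃ n, PiNat.cylinder z n ⊆ f ⁻¹' K := by
    obtain ⟨_, ⟨y, n, rfl⟩, hz, hsub⟩ :=
      (PiNat.isTopologicalBasis_cylinders (fun _ : ℕ => ℕ)).mem_nhds_iff.1
        (hf.continuousAt.preimage_mem_nhds hK)
    refine ⟨n, ?_⟩
    rwa [PiNat.mem_cylinder_iff_eq.1 hz]
  refine hxK (closure_minimal ?_ hKc (hBA _ (hbr n)))
  rintro _ ⟨y, hy, rfl⟩
  apply hn
  rw [PiNat.cylinder_eq_res]
  have hlen : (br n).length = n := by rw [← hres, PiNat.res_length]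
  change PiNat.res y (br n).length = br n at hy
  rw [hlen, ← hres] at hy
  exact hy

/-! ### Continuity of Borel maps on residual sets -/

/-- On a residual set, the value of a Borel map at the limit of a sequence is determined by its
values along the sequence if these are constant. This follows from continuity on a residual set,
and makes no reference to a topology of the codomain. -/
theorem Measurable.exists_residual_forall_eq_of_tendsto {X Y : Type*} [TopologicalSpace X]
    [MeasurableSpace X] [BorelSpace X] [MeasurableSpace Y] [MeasurableSpace.CountablySeparated Y]
    {F : X → Y} (hF : Measurable F) :
    ∃ D ∈ residual X, ∀ x ∈ D, ∀ u : ℕ → X, (∀ n, u n ∈ D) → Tendsto u atTop (𝓝 x) →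
      ∀ c, (∀ n, F (u n) = c) → F x = c := by
  obtain ⟨A, hA, hsep⟩ := exists_seq_separating Y MeasurableSet.empty Set.univ
  choose O hO hAO using fun n => (hF (hA n)).residualEq_isOpen
  choose O' hO' hAO' using fun n => (hF (hA n).compl).residualEq_isOpen
  refine ⟨{x | ∀ n, (F x ∈ A n ↔ x ∈ O n) ∧ (F x ∈ (A n)ᶜ ↔ x ∈ O' n)}, ?_, ?_⟩
  · refine eventually_countable_forall.2 fun n => ?_
    filter_upwards [hAO n, hAO' n] with x h h'
    exact ⟨iff_of_eq h, iff_of_eq h'⟩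
  · intro x hx u hu hux c hc
    refine hsep _ trivial _ trivial fun n => ?_
    by_cases h : F x ∈ A n
    · obtain ⟨m, hm⟩ := (hux.eventually ((hO n).mem_nhds ((hx n).1.1 h))).exists
      simp only [h, true_iff]
      rw [← hc m]
      exact (hu m n).1.2 hm
    · obtain ⟨m, hm⟩ := (hux.eventually ((hO' n).mem_nhds ((hx n).2.1 h))).exists
      simp only [h, false_iff]
      rw [← hc m]
      exact (hu m n).2.2 hm

/-! ### Convergence in CLI groups -/

/-- In a CLI group, a sequence converges if its successive left increments `g (n + 1) * (g n)⁻¹` lie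
in a suitable sequence of neighbourhoods of `1`: then the inverses form a Cauchy sequence for the
complete left-invariant metric. -/
theorem IsCLIGroup.exists_seq_nhds_one_tendsto (G : Type*) [Group G] [TopologicalSpace G]
    [IsCLIGroup G] :
    ∃ W : ℕ → Set G, (∀ n, W n ∈ 𝓝 1) ∧
      ∀ g : ℕ → G, (∀ n, g (n + 1) * (g n)⁻¹ ∈ W n) → ∃ a, Tendsto g atTop (𝓝 a) := by
  obtain ⟨m, hm, hc, hinv⟩ := IsCLIGroup.exists_complete_leftInvariant_metric (G := G)
  -- The metric is transported along the equality of topologies, so that it induces the given one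
  -- definitionally.
  let m' : MetricSpace G := m.replaceTopology hm.symm
  have hinv' : ∀ g x y : G, dist (g * x) (g * y) = dist x y := hinv
  have hc' : CompleteSpace G := by
    convert hc
    exact MetricSpace.replaceTopology_eq m hm.symm
  have hlim : Tendsto (fun w : G => dist 1 w⁻¹) (𝓝 1) (𝓝 0) := by
    have : Continuous fun w : G => dist 1 w⁻¹ := by fun_prop
    simpa using this.tendsto 1
  refine ⟨fun n => {w | dist 1 w⁻¹ < (1 / 2) ^ n}, fun n => ?_, fun g hg => ?_⟩
  · exact hlim.eventually (gt_mem_nhds (by positivity))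
  · have hd : ∀ n, dist (g n)⁻¹ (g (n + 1))⁻¹ ≤ 1 * (1 / 2) ^ n := by
      intro n
      have h : dist 1 (g (n + 1) * (g n)⁻¹)⁻¹ ≤ (1 / 2) ^ n := le_of_lt (hg n)
      rw [← hinv' (g n)⁻¹] at h
      simpa [mul_assoc] using h
    obtain ⟨a, ha⟩ := cauchySeq_tendsto_of_complete
      (cauchySeq_of_le_geometric (1 / 2) 1 (by norm_num) hd)
    exact ⟨a⁻¹, by simpa using ha.inv⟩

/-! ### Orbit continuity -/

theorem baireMeasurableSet_setOf_exists_smul_eq {X Y S G : Type*}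
    [TopologicalSpace X] [PolishSpace X] [MeasurableSpace X] [BorelSpace X]
    [Group S] [TopologicalSpace S] [PolishSpace S] [MulAction S X] [ContinuousSMul S X]
    [Group G] [TopologicalSpace G] [PolishSpace G] [MeasurableSpace G] [BorelSpace G]
    [MeasurableSpace Y] [StandardBorelSpace Y] [MulAction G Y] [MeasurableSMul₂ G Y]
    {f : X → Y} (hf : Measurable f) {W : Set G}
    (hW : IsOpen W) : BaireMeasurableSet {q : S × X | ∃ g ∈ W, f (q.1 • q.2) = g • f q.2} := by
  borelize S
  refine AnalyticSet.baireMeasurableSet ?_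
  have h : MeasurableSet {q : (S × X) × G | q.2 ∈ W ∧ f (q.1.1 • q.1.2) = q.2 • f q.1.2} := by
    refine (measurable_snd hW.measurableSet).inter (measurableSet_eq_fun ?_ ?_)
    · have : Continuous fun q : (S × X) × G => q.1.1 • q.1.2 := by fun_prop
      exact hf.comp this.measurable
    · exact measurable_snd.smul (hf.comp measurable_fst.snd)
  convert h.analyticSet.image_of_continuous continuous_fst using 1
  ext q
  simp

theorem eventually_residual_smul {X S : Type*} [TopologicalSpace X] [Group S]
    [TopologicalSpace S] [IsTopologicalGroup S] [MulAction S X] [ContinuousSMul S X]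
    {p : X → Prop} (h : ∀ᶠ x in residual X, p x) :
    ∀ᶠ q : S × X in residual (S × X), p (q.1 • q.2) := by
  let e : S × X ≃ₜ S × X :=
    { toFun := fun q => (q.1, q.1 • q.2)
      invFun := fun q => (q.1, q.1⁻¹ • q.2)
      left_inv := fun q => by simp
      right_inv := fun q => by simp
      continuous_toFun := by fun_prop
      continuous_invFun := by fun_prop }
  exact (tendsto_residual_of_isOpenMap (f := fun q => (e q).2) (by fun_prop)
    (isOpenMap_snd.comp e.isOpenMap)).eventually h

/-- Orbit continuity of a Borel map `f` that sends `S`-orbits into `G`-orbits: every nonempty open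
set contains a nonempty open set `U` on which, for generic `x ∈ U` and generic `v` near `1`, the
value `f (v • x)` is a translate of `f x` by an element of `W`. -/
theorem exists_isOpen_forall_residual_smul_mem {X Y S G : Type*}
    [TopologicalSpace X] [PolishSpace X] [MeasurableSpace X] [BorelSpace X]
    [Group S] [TopologicalSpace S] [IsTopologicalGroup S] [PolishSpace S] [MulAction S X]
    [ContinuousSMul S X]
    [Group G] [TopologicalSpace G] [IsTopologicalGroup G] [PolishSpace G]
    [MeasurableSpace G] [BorelSpace G]
    [MeasurableSpace Y] [StandardBorelSpace Y] [MulAction G Y] [MeasurableSMul₂ G Y]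
    {f : X → Y} (hf : Measurable f)
    (hfS : ∀ (v : S) x, ∃ g : G, f (v • x) = g • f x) {W : Set G} (hW : W ∈ 𝓝 1)
    {U₀ : Set X} (hU₀ : IsOpen U₀) (hne : U₀.Nonempty) :
    ∃ U ⊆ U₀, IsOpen U ∧ U.Nonempty ∧ ∃ N ∈ 𝓝 (1 : S),
      ∀ᶠ x in residual X, x ∈ U → ∀ᶠ v in residual S, v ∈ N → ∃ g ∈ W, f (v • x) = g • f x := by
  obtain ⟨V, hV, hVo, h1V, hVW⟩ : ∃ V ∈ 𝓝 (1 : G), IsOpen V ∧ (1 : G) ∈ V ∧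
      ∀ a ∈ V, ∀ b ∈ V, a * b⁻¹ ∈ W := by
    have : Tendsto (fun p : G × G => p.1 * p.2⁻¹) (𝓝 (1, 1)) (𝓝 1) := by
      have : Continuous fun p : G × G => p.1 * p.2⁻¹ := by fun_prop
      simpa using this.tendsto (1, 1)
    have h := this hW
    rw [mem_map, nhds_prod_eq, mem_prod_same_iff] at h
    obtain ⟨t, ht, hsub⟩ := h
    obtain ⟨V, hVt, hVo, h1⟩ := mem_nhds_iff.1 ht
    exact ⟨V, hVo.mem_nhds h1, hVo, h1, fun a ha b hb => @hsub (a, b) ⟨hVt ha, hVt hb⟩⟩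
  -- Countably many right translates of `V` cover `G`.
  obtain ⟨c, hc⟩ : ∃ c : ℕ → G, DenseRange c := TopologicalSpace.exists_dense_seq G
  have hcov : ∀ g, ∃ i, g * (c i)⁻¹ ∈ V := by
    intro g
    have ho : IsOpen {a : G | g * a⁻¹ ∈ V} := hVo.preimage (by fun_prop)
    exact hc.exists_mem_open ho ⟨g, by simpa using h1V⟩
  let Q : ℕ → Set (S × X) := fun i =>
    {q | ∃ g ∈ (fun g => g * (c i)⁻¹) ⁻¹' V, f (q.1 • q.2) = g • f q.2}
  have hQ : ∀ i, BaireMeasurableSet (Q i) := fun i =>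
    baireMeasurableSet_setOf_exists_smul_eq hf (hVo.preimage (by fun_prop))
  choose O hO hQO using fun i => (hQ i).residualEq_isOpen
  have hD : ∀ᶠ q in residual (S × X), ∀ i, q ∈ Q i ↔ q ∈ O i :=
    eventually_countable_forall.2 fun i => (hQO i).mono fun q hq => iff_of_eq hq
  obtain ⟨⟨v₁, x₁⟩, hq₁, hqD⟩ : ((fun q : S × X => q.1 • q.2) ⁻¹' U₀ ∩
      {q | ∀ i, q ∈ Q i ↔ q ∈ O i}).Nonempty :=
    (dense_of_mem_residual hD).inter_open_nonempty _ (hU₀.preimage (by fun_prop))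
      (by obtain ⟨x, hx⟩ := hne; exact ⟨(1, x), by simpa using hx⟩)
  obtain ⟨i, hi⟩ : ∃ i, (v₁, x₁) ∈ O i := by
    obtain ⟨g, hg⟩ := hfS v₁ x₁
    obtain ⟨i, hi⟩ := hcov g
    exact ⟨i, (hqD i).1 ⟨g, hi, hg⟩⟩
  -- A rectangle inside `O i` which the action maps into `U₀`.
  obtain ⟨N, U, hN, hvN, hU, hxU, hNU⟩ : ∃ (N : Set S) (U : Set X), IsOpen N ∧ v₁ ∈ N ∧ IsOpen U ∧
      x₁ ∈ U ∧ N ×ˢ U ⊆ O i ∩ (fun q : S × X => q.1 • q.2) ⁻¹' U₀ := by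
    have ho : IsOpen (O i ∩ (fun q : S × X => q.1 • q.2) ⁻¹' U₀) :=
      (hO i).inter (hU₀.preimage (by fun_prop))
    obtain ⟨N, U, h1, h2, h3, h4, h5⟩ := isOpen_prod_iff.1 ho v₁ x₁ ⟨hi, hq₁⟩
    exact ⟨N, U, h1, h3, h2, h4, h5⟩
  have hD' : ∀ᶠ x in residual X, ∀ᶠ v in residual S, (v, x) ∈ Q i ↔ (v, x) ∈ O i := by
    have : ∀ᶠ q in residual (X × S), q.swap ∈ Q i ↔ q.swap ∈ O i :=
      (tendsto_residual_of_isOpenMap continuous_swap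
        (Homeomorph.prodComm X S).isOpenMap).eventually (hD.mono fun q hq => hq i)
    exact this.residual_prod
  -- A generic `v ∈ N`. It moves the rectangle `N ×ˢ U` to a neighbourhood of `1` times an open set.
  obtain ⟨v, hvD, hv⟩ : (N ∩ {v | ∀ᶠ x in residual X,
      (v, x) ∈ Q i ↔ (v, x) ∈ O i}).Nonempty := by
    have := (hD.mono fun q hq => hq i).residual_prod
    exact (dense_of_mem_residual this).inter_open_nonempty N hN ⟨v₁, hvN⟩
  refine ⟨(fun x => v⁻¹ • x) ⁻¹' U, fun x hx => ?_, hU.preimage (by fun_prop),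
    ⟨v • x₁, by simpa using hxU⟩, (fun w => w * v) ⁻¹' N, ?_, ?_⟩
  · simpa using (hNU (show (v, v⁻¹ • x) ∈ N ×ˢ U from ⟨hvD, hx⟩)).2
  · exact (hN.preimage (by fun_prop)).mem_nhds (by simpa using hvD)
  · have htr : Tendsto (fun x : X => v⁻¹ • x) (residual X) (residual X) :=
      tendsto_residual_of_isOpenMap (by fun_prop) (isOpenMap_smul _)
    have htr' : Tendsto (fun w : S => w * v) (residual S) (residual S) :=
      tendsto_residual_of_isOpenMap (by fun_prop) (isOpenMap_mul_right _)
    filter_upwards [htr.eventually hv, htr.eventually hD'] with x hx hx' hxU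
    filter_upwards [htr'.eventually hx'] with w hw hwN
    obtain ⟨a, ha, hax⟩ := hx.2 (hNU (show (v, v⁻¹ • x) ∈ N ×ˢ U from ⟨hvD, hxU⟩)).1
    obtain ⟨b, hb, hbx⟩ := hw.2 (hNU (show (w * v, v⁻¹ • x) ∈ N ×ˢ U from ⟨hwN, hxU⟩)).1
    -- With `c i` the centre of the translate, `b * a⁻¹ = (b * (c i)⁻¹) * (a * (c i)⁻¹)⁻¹`.
    refine ⟨b * a⁻¹, by simpa [mul_assoc] using hVW _ hb _ ha, ?_⟩
    simp only [smul_inv_smul, mul_smul] at hax hbx ⊢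
    rw [hbx, hax, inv_smul_smul]

/-! ### Limits along generic orbits -/

/-- Let `f` be a Borel map that sends `S`-orbits into orbits of a CLI group `G`. For generic `z` and
`x`, the points `f z` and `f x` lie in the same orbit as soon as the orbit of `z` approaches `x` in
the following sense: there are decreasing sets `T m`, open along orbits and met by the orbit of `z`,
which shrink to `x` and such that, within any neighbourhood of `1` in `S`, points of `T m` with `m`
large can be moved into every `T k`. -/
theorem exists_residual_forall_exists_smul_eq {X Y S G : Type*}
    [TopologicalSpace X] [PolishSpace X] [MeasurableSpace X] [BorelSpace X]
    [Group S] [TopologicalSpace S] [IsTopologicalGroup S] [PolishSpace S] [MulAction S X]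
    [ContinuousSMul S X]
    [Group G] [TopologicalSpace G] [IsCLIGroup G] [MeasurableSpace G] [BorelSpace G]
    [MeasurableSpace Y] [StandardBorelSpace Y] [MulAction G Y] [MeasurableSMul₂ G Y]
    {f : X → Y} (hf : Measurable f) (hfS : ∀ (v : S) x, ∃ g : G, f (v • x) = g • f x) :
    ∃ D ∈ residual X, ∀ z ∈ D, ∀ x ∈ D, ∀ T : ℕ → Set X, Antitone T →
      (∀ m, ∃ v : S, v • z ∈ T m) →
      (∀ m y, IsOpen {v : S | v • y ∈ T m}) →
      (∀ U ∈ 𝓝 x, ∀ N ∈ 𝓝 (1 : S), ∃ m, T m ⊆ U ∧ ∀ y ∈ T m, ∀ k, ∃ v ∈ N, v • y ∈ T k) →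
      ∃ g : G, f x = g • f z := by
  obtain ⟨W, hW, hWlim⟩ := IsCLIGroup.exists_seq_nhds_one_tendsto G
  obtain ⟨C, hC, hClim⟩ := Measurable.exists_residual_forall_eq_of_tendsto
    (F := fun q : X × G => q.2 • f q.1) (measurable_snd.smul (hf.comp measurable_fst))
  obtain ⟨B, hB⟩ := (𝓝 (1 : S)).exists_antitone_basis
  let bX := TopologicalSpace.countableBasis X
  let R : ℕ → S → X → Prop := fun n v x => ∃ g ∈ W n, f (v • x) = g • f x
  let P : ℕ → Set X → ℕ → Prop := fun n U j =>
    ∀ᶠ x in residual X, x ∈ U → ∀ᶠ v in residual S, v ∈ B j → R n v x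
  -- In `D₀`, the second clause provides a neighbourhood on which orbit continuity holds generically;
  -- the third one says that the point is not exceptional for any basic instance of it.
  let D₀ : Set X := {x | (∀ᶠ h in residual G, (x, h) ∈ C) ∧ (∀ n, ∃ U ∈ bX, ∃ j, x ∈ U ∧ P n U j) ∧
    ∀ n, ∀ U ∈ bX, ∀ j, P n U j → x ∈ U → ∀ᶠ v in residual S, v ∈ B j → R n v x}
  have hD₀ : ∀ᶠ x in residual X, x ∈ D₀ := by
    refine Filter.Eventually.and ?_ (Filter.Eventually.and ?_ ?_)
    · exact Filter.Eventually.residual_prod (p := fun q => q ∈ C) hC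
    · refine eventually_countable_forall.2 fun n => ?_
      have heq : {x | ∃ U ∈ bX, ∃ j, x ∈ U ∧ P n U j} = ⋃₀ {U ∈ bX | ∃ j, P n U j} := by
        ext x
        simp only [mem_ofPred_eq, mem_sUnion]
        constructor
        · rintro ⟨U, hU, j, hx, hP⟩
          exact ⟨U, ⟨hU, j, hP⟩, hx⟩
        · rintro ⟨U, ⟨hU, j, hP⟩, hx⟩
          exact ⟨U, hU, j, hx, hP⟩
      refine residual_of_dense_open (s := {x | ∃ U ∈ bX, ∃ j, x ∈ U ∧ P n U j}) ?_ ?_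
      · rw [heq]
        exact isOpen_sUnion fun U hU => TopologicalSpace.isOpen_of_mem_countableBasis hU.1
      · refine dense_iff_inter_open.2 fun U₀ hU₀ hne => ?_
        obtain ⟨U, hUU₀, hU, ⟨x, hx⟩, N, hN, hUN⟩ :=
          exists_isOpen_forall_residual_smul_mem hf hfS (hW n) hU₀ hne
        obtain ⟨V, hV, hxV, hVU⟩ :=
          (TopologicalSpace.isBasis_countableBasis X).exists_subset_of_mem_open hx hU
        obtain ⟨j, -, hj⟩ := hB.1.mem_iff.1 hN
        refine ⟨x, hUU₀ hx, V, hV, j, hxV, ?_⟩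
        filter_upwards [hUN] with y hy hyV
        exact (hy (hVU hyV)).mono fun v hv hvj => hv (hj hvj)
    · refine eventually_countable_forall.2 fun n =>
        (eventually_countable_ball (TopologicalSpace.countable_countableBasis X)).2 fun U hU =>
        eventually_countable_forall.2 fun j => ?_
      by_cases hP : P n U j
      · exact hP.mono fun x hx _ => hx
      · exact Eventually.of_forall fun x h => absurd h hP
  -- Unlike `D₀`, the set `D` is preserved by generic elements of `S`.
  let D : Set X := {x | x ∈ D₀ ∧ ∀ᶠ v in residual S, v • x ∈ D₀}
  have hD : ∀ᶠ x in residual X, x ∈ D := by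
    refine hD₀.and ?_
    have : ∀ᶠ q in residual (X × S), q.2 • q.1 ∈ D₀ :=
      (tendsto_residual_of_isOpenMap continuous_swap
        (Homeomorph.prodComm X S).isOpenMap).eventually (eventually_residual_smul (S := S) hD₀)
    exact this.residual_prod
  have hDsmul : ∀ x ∈ D, ∀ᶠ v in residual S, v • x ∈ D := by
    intro x hx
    have : ∀ᶠ q : S × S in residual (S × S), (q.2 • q.1) • x ∈ D₀ :=
      (tendsto_residual_of_isOpenMap continuous_swap
        (Homeomorph.prodComm S S).isOpenMap).eventually (eventually_residual_smul (S := S) hx.2)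
    filter_upwards [hx.2, this.residual_prod] with v hv hv'
    exact ⟨hv, by simpa [mul_smul] using hv'⟩
  refine ⟨D, hD, fun z hz x hx T hT hzT hTo hTx => ?_⟩
  choose U hU j hxU hP using hx.1.2.1
  obtain ⟨b, hb⟩ := (𝓝 x).exists_antitone_basis
  choose m hmU hmv using fun n => hTx (U n ∩ b n)
    (inter_mem ((TopologicalSpace.isOpen_of_mem_countableBasis (hU n)).mem_nhds (hxU n))
      (hb.1.mem_of_mem trivial)) (interior (B (j n)))
    (interior_mem_nhds.2 (hB.1.mem_of_mem trivial))
  have hstep : ∀ n y, y ∈ T (m n) ∩ D →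
      ∃ y' ∈ T (m (n + 1)) ∩ D, ∃ g ∈ W n, f y' = g • f y := by
    rintro n y ⟨hyT, hyD⟩
    obtain ⟨v₀, hv₀⟩ := hmv n y hyT (m (n + 1))
    obtain ⟨v, ⟨hvN, hvT⟩, hvD, hvR⟩ := (dense_of_mem_residual ((hDsmul y hyD).and
        (hyD.1.2.2 n (U n) (hU n) (j n) (hP n) (hmU n hyT).1))).inter_open_nonempty
        _ (isOpen_interior.inter (hTo (m (n + 1)) y)) ⟨v₀, hv₀⟩
    exact ⟨v • y, ⟨hvT, hvD⟩, hvR (interior_subset hvN)⟩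
  obtain ⟨v₀, hv₀T, hv₀D⟩ := (dense_of_mem_residual (hDsmul z hz)).inter_open_nonempty
    _ (hTo (m 0) z) (hzT (m 0))
  obtain ⟨g₀, hg₀⟩ := hfS v₀ z
  choose! nxt hnxt a haW ha using hstep
  let y : ℕ → X := fun n => Nat.rec (v₀ • z) nxt n
  have hy : ∀ n, y n ∈ T (m n) ∩ D := by
    intro n
    induction n with
    | zero => exact ⟨hv₀T, hv₀D⟩
    | succ n ih => exact hnxt n _ ih
  let g : ℕ → G := fun n => Nat.rec g₀ (fun n g => a n (y n) * g) n
  have hg : ∀ n, f (y n) = g n • f z := by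
    intro n
    induction n with
    | zero => exact hg₀
    | succ n ih =>
      change f (nxt n (y n)) = (a n (y n) * g n) • f z
      rw [ha n _ (hy n), ih, mul_smul]
  obtain ⟨g', hg'⟩ := hWlim g fun n => by
    have : g (n + 1) = a n (y n) * g n := rfl
    rw [this, mul_inv_cancel_right]
    exact haW n _ (hy n)
  have hyx : Tendsto y atTop (𝓝 x) := hb.tendsto fun n => (hmU n (hy n).1).2
  -- For generic `h`, the points `(y n, h * g' * (g n)⁻¹)`, at which `(x, h) ↦ h • f x` takes the
  -- value `(h * g') • f z`, lie in `C` together with their limit `(x, h)`.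
  have hgen : ∀ᶠ h in residual G, (x, h) ∈ C ∧ ∀ n, (y n, h * (g' * (g n)⁻¹)) ∈ C := by
    refine hx.1.1.and (eventually_countable_forall.2 fun n => ?_)
    have htr : Tendsto (fun h : G => h * (g' * (g n)⁻¹)) (residual G) (residual G) :=
      tendsto_residual_of_isOpenMap (by fun_prop) (isOpenMap_mul_right _)
    exact htr.eventually (hy n).2.1.1
  obtain ⟨h, hhx, hhy⟩ := (dense_of_mem_residual hgen).nonempty
  have hlim : Tendsto (fun n => (y n, h * (g' * (g n)⁻¹))) atTop (𝓝 (x, h)) := by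
    refine hyx.prodMk_nhds ?_
    have : Tendsto (fun n => h * (g' * (g n)⁻¹)) atTop (𝓝 (h * (g' * g'⁻¹))) :=
      (hg'.inv.const_mul g').const_mul h
    simpa using this
  have := hClim (x, h) hhx _ hhy hlim ((h * g') • f z) fun n => by
    simp [hg, ← mul_smul, mul_assoc]
  refine ⟨g', ?_⟩
  rwa [mul_smul, smul_left_cancel_iff] at this

/-! ### The Polish group of permutations of the natural numbers -/

/-- The topology of pointwise convergence of a permutation and of its inverse. -/
instance Equiv.Perm.natTopologicalSpace : TopologicalSpace (Equiv.Perm ℕ) :=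
  TopologicalSpace.induced (fun v => ((v : ℕ → ℕ), (v.symm : ℕ → ℕ))) inferInstance

namespace Equiv.Perm

theorem continuous_apply (i : ℕ) : Continuous fun v : Equiv.Perm ℕ => v i := by
  have h : Continuous fun q : (ℕ → ℕ) × (ℕ → ℕ) => q.1 i := by fun_prop
  exact h.comp (continuous_induced_dom (f := fun v : Equiv.Perm ℕ =>
    ((v : ℕ → ℕ), (v.symm : ℕ → ℕ))))

theorem continuous_symm_apply (i : ℕ) : Continuous fun v : Equiv.Perm ℕ => v.symm i := by
  have h : Continuous fun q : (ℕ → ℕ) × (ℕ → ℕ) => q.2 i := by fun_prop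
  exact h.comp (continuous_induced_dom (f := fun v : Equiv.Perm ℕ =>
    ((v : ℕ → ℕ), (v.symm : ℕ → ℕ))))

theorem continuous_iff {A : Type*} [TopologicalSpace A] {φ : A → Equiv.Perm ℕ} :
    Continuous φ ↔ (∀ i, Continuous fun a => φ a i) ∧ ∀ i, Continuous fun a => (φ a).symm i := by
  rw [continuous_induced_rng, continuous_prodMk, continuous_pi_iff, continuous_pi_iff]
  rfl

theorem isClosedEmbedding_prodMk_symm :
    IsClosedEmbedding fun v : Equiv.Perm ℕ => ((v : ℕ → ℕ), (v.symm : ℕ → ℕ)) := by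
  refine ⟨⟨⟨rfl⟩, fun v w h => DFunLike.coe_injective (Prod.ext_iff.1 h).1⟩, ?_⟩
  have heq : range (fun v : Equiv.Perm ℕ => ((v : ℕ → ℕ), (v.symm : ℕ → ℕ))) =
      {q | ∀ i, q.2 (q.1 i) = i ∧ q.1 (q.2 i) = i} := by
    ext ⟨a, b⟩
    constructor
    · rintro ⟨v, hv⟩
      obtain ⟨rfl, rfl⟩ := Prod.ext_iff.1 hv
      simp
    · intro h
      exact ⟨⟨a, b, fun i => (h i).1, fun i => (h i).2⟩, rfl⟩
  rw [heq]
  have hev : Continuous fun q : (ℕ → ℕ) × ℕ => q.1 q.2 :=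
    continuous_prod_of_discrete_right.2 fun i => _root_.continuous_apply i
  simp only [ofPred_forall, ofPred_and]
  refine isClosed_iInter fun i => (isClosed_eq ?_ continuous_const).inter
    (isClosed_eq ?_ continuous_const)
  · exact hev.comp (continuous_snd.prodMk ((_root_.continuous_apply i).comp continuous_fst))
  · exact hev.comp (continuous_fst.prodMk ((_root_.continuous_apply i).comp continuous_snd))

instance : PolishSpace (Equiv.Perm ℕ) := isClosedEmbedding_prodMk_symm.polishSpace

instance : IsTopologicalGroup (Equiv.Perm ℕ) where
  continuous_mul := by
    have h1 : Continuous fun q : Equiv.Perm ℕ × ℕ => q.1 q.2 :=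
      continuous_prod_of_discrete_right.2 continuous_apply
    have h2 : Continuous fun q : Equiv.Perm ℕ × ℕ => q.1.symm q.2 :=
      continuous_prod_of_discrete_right.2 continuous_symm_apply
    refine continuous_iff.2 ⟨fun i => ?_, fun i => ?_⟩
    · exact h1.comp (continuous_fst.prodMk ((continuous_apply i).comp continuous_snd))
    · exact h2.comp (continuous_snd.prodMk ((continuous_symm_apply i).comp continuous_fst))
  continuous_inv := continuous_iff.2 ⟨continuous_symm_apply, continuous_apply⟩

-- The action of permutations on sequences by `(v • x) i = x (v⁻¹ i)`.
attribute [local instance] arrowAction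

theorem arrowAction_apply {α : Type*} (v : Equiv.Perm ℕ) (x : ℕ → α) (i : ℕ) :
    (v • x) i = x (v.symm i) := rfl

theorem continuousSMul_arrow (α : Type*) [TopologicalSpace α] :
    ContinuousSMul (Equiv.Perm ℕ) (ℕ → α) where
  continuous_smul := by
    have hev : Continuous fun q : (ℕ → α) × ℕ => q.1 q.2 :=
      continuous_prod_of_discrete_right.2 fun i => _root_.continuous_apply i
    refine continuous_pi fun i => ?_
    exact hev.comp (continuous_snd.prodMk ((continuous_symm_apply i).comp continuous_fst))

end Equiv.Perm

theorem exists_forall_eq_of_lt_mem_of_mem_nhds {α : Type*} [TopologicalSpace α] {x : ℕ → α}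
    {U : Set (ℕ → α)} (hU : U ∈ 𝓝 x) : ∃ m, ∀ y : ℕ → α, (∀ i < m, y i = x i) → y ∈ U := by
  rw [nhds_pi, Filter.mem_pi] at hU
  obtain ⟨I, hI, t, ht, hsub⟩ := hU
  obtain ⟨m, hm⟩ := hI.bddAbove
  refine ⟨m + 1, fun y hy => hsub fun i hi => ?_⟩
  rw [hy i (Nat.lt_succ_of_le (hm hi))]
  exact mem_of_mem_nhds (ht i)

theorem Equiv.Perm.exists_forall_mem_of_mem_nhds_one {N : Set (Equiv.Perm ℕ)}
    (hN : N ∈ 𝓝 (1 : Equiv.Perm ℕ)) :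
    ∃ m, ∀ v : Equiv.Perm ℕ, (∀ i < m, v i = i) → v ∈ N := by
  rw [nhds_induced, mem_comap] at hN
  obtain ⟨N', hN', hsub⟩ := hN
  rw [nhds_prod_eq, mem_prod_iff] at hN'
  obtain ⟨A, hA, B, hB, hAB⟩ := hN'
  obtain ⟨m, hm⟩ := exists_forall_eq_of_lt_mem_of_mem_nhds hA
  obtain ⟨k, hk⟩ := exists_forall_eq_of_lt_mem_of_mem_nhds hB
  refine ⟨max m k, fun v hv => hsub (hAB ⟨hm _ fun i hi => ?_, hk _ fun i hi => ?_⟩)⟩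
  · exact hv i (lt_max_of_lt_left hi)
  · exact v.symm_apply_eq.2 (hv i (lt_max_of_lt_right hi)).symm

/-! ### Generic sequences of reals -/

theorem eventually_residual_injective : ∀ᶠ z : ℕ → ℝ in residual (ℕ → ℝ), Function.Injective z := by
  have h : ∀ i j, i ≠ j → ∀ᶠ z : ℕ → ℝ in residual (ℕ → ℝ), z i ≠ z j := by
    intro i j hij
    refine residual_of_dense_open (s := {z : ℕ → ℝ | z i ≠ z j})
      (isOpen_ne_fun (continuous_apply i) (continuous_apply j)) ?_
    refine dense_iff_inter_open.2 fun O hO ⟨z, hz⟩ => ?_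
    have hc : Continuous fun t : ℝ => Function.update z i t := by fun_prop
    obtain ⟨t, htO, ht⟩ := dense_iff_inter_open.1 (dense_compl_singleton (z j)) _
      (hO.preimage hc) ⟨z i, by simpa using hz⟩
    exact ⟨_, htO, by simpa [hij.symm] using ht⟩
  have h' : ∀ᶠ z : ℕ → ℝ in residual (ℕ → ℝ), ∀ i j, i ≠ j → z i ≠ z j :=
    eventually_countable_forall.2 fun i => eventually_countable_forall.2 fun j => by
      by_cases hij : i = j
      · simp [hij]
      · simpa [hij] using h i j hij
  filter_upwards [h'] with z hz i j hij
  by_contra hne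
  exact hz i j hne hij

section

attribute [local instance] arrowAction

/-- If the injective sequence `x` takes its values in the range of `y` and agrees with `y` below `m`,
a permutation fixing the numbers below `m` rearranges `y` so as to agree with `x` below `k`. -/
theorem exists_perm_smul_eq_below {α : Type*} {x y : ℕ → α} (hx : Function.Injective x)
    (hy : range x ⊆ range y) {m : ℕ} (hm : ∀ i < m, y i = x i) (k : ℕ) :
    ∃ v : Equiv.Perm ℕ, (∀ i < m, v i = i) ∧ ∀ i < k, (v • y) i = x i := by
  induction k with
  | zero => exact ⟨1, fun i _ => rfl, by simp⟩
  | succ k ih =>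
    obtain ⟨v, hvm, hvk⟩ := ih
    rcases lt_or_ge k m with hkm | hkm
    · exact ⟨1, fun i _ => rfl, fun i hi => by
        rw [one_smul]; exact hm i (by omega)⟩
    obtain ⟨q, hq⟩ : ∃ q, (v • y) q = x k := by
      obtain ⟨p, hp⟩ := hy ⟨k, rfl⟩
      exact ⟨v p, by rw [Equiv.Perm.arrowAction_apply, v.symm_apply_apply, hp]⟩
    have hkq : k ≤ q := by
      by_contra hlt
      rw [hvk q (by omega)] at hq
      exact hlt (hx hq).ge
    -- Positions below `k` are already correct, so `q ≥ k` and the swap leaves them alone.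
    refine ⟨Equiv.swap k q * v, fun i hi => ?_, fun i hi => ?_⟩
    · rw [Equiv.Perm.mul_apply, hvm i hi, Equiv.swap_apply_of_ne_of_ne (by omega) (by omega)]
    · rw [mul_smul, Equiv.Perm.arrowAction_apply, Equiv.symm_swap]
      rcases Nat.lt_succ_iff_lt_or_eq.1 hi with hi | rfl
      · rw [Equiv.swap_apply_of_ne_of_ne (by omega) (by omega), hvk i hi]
      · rw [Equiv.swap_apply_left, hq]

/-- A Borel map from real sequences to `Y` which is invariant under permutations up to the action of
a CLI group `G` identifies, up to `G`, two sequences with different ranges. -/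
theorem exists_range_ne_of_forall_perm {Y G : Type*}
    [Group G] [TopologicalSpace G] [IsCLIGroup G] [MeasurableSpace G] [BorelSpace G]
    [MeasurableSpace Y] [StandardBorelSpace Y] [MulAction G Y] [MeasurableSMul₂ G Y]
    {f : (ℕ → ℝ) → Y} (hf : Measurable f)
    (hperm : ∀ (v : Equiv.Perm ℕ) x, ∃ g : G, f (x ∘ v) = g • f x) :
    ∃ x z : ℕ → ℝ, range x ≠ range z ∧ ∃ g : G, f x = g • f z := by
  have := Equiv.Perm.continuousSMul_arrow ℝ
  obtain ⟨D, hD, hDT⟩ := exists_residual_forall_exists_smul_eq (S := Equiv.Perm ℕ) hf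
    fun v x => hperm v.symm x
  -- Every other term of a generic sequence is a generic sequence.
  let e : (ℕ → ℝ) ≃ₜ (ℕ → ℝ) × (ℕ → ℝ) :=
    (Homeomorph.piCongrLeft (Y := fun _ => ℝ) Equiv.natSumNatEquivNat).symm.trans
      Homeomorph.sumArrowHomeomorphProdArrow
  have heven : ∀ᶠ z in residual (ℕ → ℝ), (e z).1 ∈ D :=
    (tendsto_residual_of_isOpenMap (f := fun z => (e z).1) (by fun_prop)
      (isOpenMap_fst.comp e.isOpenMap)).eventually hD
  obtain ⟨z, hzD, hxD, hz⟩ :=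
    (dense_of_mem_residual
      (inter_mem hD (inter_mem heven eventually_residual_injective))).nonempty
  have hxz : ∀ i, (e z).1 i = z (2 * i) := fun i => rfl
  change (e z).1 ∈ D at hxD
  generalize (e z).1 = x at hxD hxz
  have hsub : range x ⊆ range z := by
    rintro _ ⟨i, rfl⟩
    exact ⟨2 * i, (hxz i).symm⟩
  have hx : Function.Injective x := fun i j h => by
    rw [hxz, hxz] at h
    have := hz h
    omega
  refine ⟨x, z, fun h => ?_, ?_⟩
  · obtain ⟨i, hi⟩ : z 1 ∈ range x := h ▸ ⟨1, rfl⟩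
    rw [hxz] at hi
    have := hz hi
    omega
  have horb : ∀ v : Equiv.Perm ℕ, range (v • z) = range z := fun v => by
    exact v.symm.surjective.range_comp z
  -- Sequences with the range of `z` that agree with `x` below `m`.
  let T : ℕ → Set (ℕ → ℝ) := fun m => {y | range y = range z ∧ ∀ i < m, y i = x i}
  refine hDT z hzD x hxD T ?_ ?_ ?_ ?_
  · exact fun m k hmk y hy => ⟨hy.1, fun i hi => hy.2 i (hi.trans_le hmk)⟩
  · intro m
    obtain ⟨v, -, hv⟩ := exists_perm_smul_eq_below hx hsub (m := 0) (by simp) m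
    exact ⟨v, horb v, hv⟩
  · intro m y
    have hr : ∀ v : Equiv.Perm ℕ, range (v • y) = range y := fun v => by
      exact v.symm.surjective.range_comp y
    have heq : {v : Equiv.Perm ℕ | v • y ∈ T m} =
        {v : Equiv.Perm ℕ | range y = range z} ∩ ⋂ i ∈ Iio m, {v | y (v.symm i) = x i} := by
      ext v
      simp [T, hr, Equiv.Perm.arrowAction_apply]
    rw [heq]
    refine isOpen_const.inter ((finite_Iio m).isOpen_biInter fun i _ => ?_)
    exact (isOpen_discrete {p | y p = x i}).preimage (Equiv.Perm.continuous_symm_apply i)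
  · intro U hU N hN
    obtain ⟨m, hm⟩ := exists_forall_eq_of_lt_mem_of_mem_nhds hU
    obtain ⟨k, hk⟩ := Equiv.Perm.exists_forall_mem_of_mem_nhds_one hN
    refine ⟨max m k, fun y hy => hm y fun i hi => hy.2 i (lt_max_of_lt_left hi), fun y hy l => ?_⟩
    obtain ⟨v, hv, hvl⟩ := exists_perm_smul_eq_below hx (hy.1 ▸ hsub) hy.2 l
    refine ⟨v, hk v fun i hi => hv i (lt_max_of_lt_right hi), ?_, hvl⟩
    exact (v.symm.surjective.range_comp y).trans hy.1

end

/-! ### Diagonal operators -/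

section Diagonal

variable {ι : Type*} {H : Type*} [NormedAddCommGroup H] [InnerProductSpace ℂ H]

theorem HilbertBasis.exists_reindex [CompleteSpace H] {ι' : Type*} (b : HilbertBasis ι ℂ H)
    (e : ι' ≃ ι) : ∃ b' : HilbertBasis ι' ℂ H, ∀ i, b' i = b (e i) := by
  refine ⟨HilbertBasis.mk (v := b ∘ e) (b.orthonormal.comp e e.injective) ?_, fun i => ?_⟩
  · rw [e.surjective.range_comp, b.dense_span]
  · simp

theorem nonempty_hilbertBasis_nat [CompleteSpace H] [TopologicalSpace.SeparableSpace H]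
    (hH : ¬ FiniteDimensional ℂ H) : Nonempty (HilbertBasis ℕ ℂ H) := by
  obtain ⟨w, b, hb⟩ := exists_hilbertBasis ℂ H
  -- Distinct basis vectors have distance `√2`, so the balls of radius `1 / 2` are disjoint.
  have hdist : ∀ i j : w, i ≠ j → 1 ≤ dist (i : H) j := by
    intro i j hij
    have ho := b.orthonormal
    have h := norm_sub_sq (𝕜 := ℂ) (b i) (b j)
    rw [ho.2 hij, ho.1 i, ho.1 j, hb] at h
    rw [dist_eq_norm]
    norm_num at h
    nlinarith [norm_nonneg ((i : H) - j)]
  have hcount : Countable w := by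
    refine (Set.PairwiseDisjoint.countable_of_isOpen (s := fun x : H => Metric.ball x (1 / 2))
      (fun x hx y hy hxy => Metric.ball_disjoint_ball ?_) (fun _ _ => Metric.isOpen_ball)
      fun x _ => ⟨x, Metric.mem_ball_self (by norm_num)⟩).to_subtype
    have := hdist ⟨x, hx⟩ ⟨y, hy⟩ (fun h => hxy (congrArg Subtype.val h))
    norm_num
    exact this
  have hinf : Infinite w := by
    by_contra hfin
    rw [not_infinite_iff_finite] at hfin
    have := Fintype.ofFinite w
    exact hH b.toOrthonormalBasis.toBasis.finiteDimensional_of_finite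
  obtain ⟨e⟩ := nonempty_equiv_of_countable (α := ℕ) (β := w)
  obtain ⟨b', -⟩ := b.exists_reindex e
  exact ⟨b'⟩

/-- The operator which is diagonal with respect to the Hilbert basis `b`, with entries `d` of norm at
most `1`. -/
noncomputable def HilbertBasis.diagonal (b : HilbertBasis ι ℂ H) (d : ι → ℂ)
    (hd : ∀ i, ‖d i‖ ≤ 1) : H →L[ℂ] H :=
  have hle : ∀ (u : lp (fun _ : ι => ℂ) 2) i, ‖d i * u i‖ ≤ ‖u i‖ := fun u i => by
    rw [norm_mul]
    exact mul_le_of_le_one_left (norm_nonneg _) (hd i)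
  let M : lp (fun _ : ι => ℂ) 2 →ₗ[ℂ] lp (fun _ : ι => ℂ) 2 :=
    { toFun := fun u => ⟨fun i => d i * u i, (lp.memℓp u).mono' (hle u)⟩
      map_add' := fun u v => by ext i; exact mul_add _ _ _
      map_smul' := fun c u => by ext i; simp [mul_left_comm] }
  b.repr.symm.toContinuousLinearEquiv.toContinuousLinearMap ∘L
    M.mkContinuous 1 (fun u => by
      rw [one_mul]
      exact lp.norm_mono (by norm_num) (hle u)) ∘L
    b.repr.toContinuousLinearEquiv.toContinuousLinearMap

variable (b : HilbertBasis ι ℂ H) {d : ι → ℂ} (hd : ∀ i, ‖d i‖ ≤ 1)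

@[simp]
theorem HilbertBasis.repr_diagonal (x : H) (i : ι) :
    b.repr (b.diagonal d hd x) i = d i * b.repr x i := by
  simp [HilbertBasis.diagonal]

theorem HilbertBasis.ext_repr {A B : H →L[ℂ] H}
    (h : ∀ x i, b.repr (A x) i = b.repr (B x) i) : A = B := by
  ext x
  exact b.repr.injective (by ext i; exact h x i)

theorem HilbertBasis.diagonal_self (i : ι) : b.diagonal d hd (b i) = d i • b i := by
  classical
  apply b.repr.injective
  ext j
  rw [HilbertBasis.repr_diagonal, map_smul, b.repr_self]
  by_cases h : j = i
  · subst h; simp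
  · simp [Pi.single_eq_of_ne h]

theorem HilbertBasis.mem_range_of_diagonal_eq_smul {c : ℂ} {x : H} (hx : x ≠ 0)
    (h : b.diagonal d hd x = c • x) : c ∈ range d := by
  have hne : b.repr x ≠ 0 := by simpa using hx
  obtain ⟨i, hi⟩ : ∃ i, b.repr x i ≠ 0 := by
    by_contra! hcon
    exact hne (by ext i; simpa using hcon i)
  refine ⟨i, mul_right_cancel₀ hi ?_⟩
  rw [← b.repr_diagonal hd, h]
  simp

variable [CompleteSpace H]

theorem HilbertBasis.star_diagonal :
    star (b.diagonal d hd) = b.diagonal (fun i => star (d i)) (by simpa using hd) := by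
  rw [ContinuousLinearMap.star_eq_adjoint, eq_comm, ContinuousLinearMap.eq_adjoint_iff]
  intro x y
  rw [← b.repr.inner_map_map, ← b.repr.inner_map_map x, lp.inner_eq_tsum, lp.inner_eq_tsum]
  refine tsum_congr fun i => ?_
  simp only [b.repr_diagonal, RCLike.inner_apply, map_mul, RCLike.star_def, Complex.conj_conj]
  ring

theorem HilbertBasis.isSelfAdjoint_diagonal (h : ∀ i, star (d i) = d i) :
    IsSelfAdjoint (b.diagonal d hd) := by
  rw [IsSelfAdjoint, b.star_diagonal]
  simp only [h]

theorem HilbertBasis.diagonal_mem_unitary (h : ∀ i, ‖d i‖ = 1) :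
    b.diagonal d hd ∈ unitary (H →L[ℂ] H) := by
  rw [Unitary.mem_iff, b.star_diagonal]
  constructor <;> refine b.ext_repr fun x i => ?_ <;>
    simp [← mul_assoc, Complex.conj_mul', Complex.mul_conj', h]

/-- The set of entries of a diagonal operator is its set of eigenvalues, a unitary invariant. -/
theorem HilbertBasis.range_eq_of_unitaryEquivalence {d' : ι → ℂ} (hd' : ∀ i, ‖d' i‖ ≤ 1)
    (h : unitaryEquivalence H (b.diagonal d hd) (b.diagonal d' hd')) : range d = range d' := by
  have key : ∀ {d d' : ι → ℂ} (hd : ∀ i, ‖d i‖ ≤ 1) (hd' : ∀ i, ‖d' i‖ ≤ 1),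
      unitaryEquivalence H (b.diagonal d hd) (b.diagonal d' hd') → range d ⊆ range d' := by
    rintro d d' hd hd' ⟨U, hU, hUd⟩ _ ⟨i, rfl⟩
    have hUU : ∀ x, star U (U x) = x := fun x => by
      rw [← mul_apply_eq_comp, (Unitary.mem_iff.1 hU).1,
        one_apply_eq_self]
    have hne : U (b i) ≠ 0 := fun h0 => b.orthonormal.ne_zero i (by rw [← hUU (b i), h0, map_zero])
    refine b.mem_range_of_diagonal_eq_smul hd' hne ?_
    rw [hUd, mul_apply_eq_comp, mul_apply_eq_comp, hUU, b.diagonal_self,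
      map_smul]
  exact (key hd hd' h).antisymm (key hd' hd ((unitaryEquivalence H).symm h))

theorem HilbertBasis.unitaryEquivalence_diagonal_comp (e : Equiv.Perm ι) :
    unitaryEquivalence H (b.diagonal d hd) (b.diagonal (d ∘ e) fun i => hd (e i)) := by
  obtain ⟨b', hb'⟩ := b.exists_reindex e
  have hrepr : ∀ x i, b'.repr x i = b.repr x (e i) := fun x i => by
    rw [b'.repr_apply_apply, b.repr_apply_apply, hb']
  -- The unitary operator with `b (e i) ↦ b i`.
  let V : H ≃ₗᵢ[ℂ] H := b'.repr.trans b.repr.symm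
  let U := Unitary.linearIsometryEquiv.symm V
  refine ⟨U, U.2, b.ext_repr fun x i => ?_⟩
  have hV : ∀ y i, b.repr ((U : H →L[ℂ] H) y) i = b.repr y (e i) := fun y i => by
    have : (U : H →L[ℂ] H) y = V y := rfl
    rw [this, ← hrepr]
    simp [V]
  have hUU : (U : H →L[ℂ] H) (star (U : H →L[ℂ] H) x) = x := by
    rw [← mul_apply_eq_comp, (Unitary.mem_iff.1 U.2).2, one_apply_eq_self]
  rw [mul_apply_eq_comp, mul_apply_eq_comp, hV, b.repr_diagonal,
    b.repr_diagonal, ← hV, hUU, Function.comp_apply]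

/-- Diagonal operators depend continuously on their entries, for pointwise convergence of the
entries and the weak operator topology. -/
theorem HilbertBasis.continuous_diagonal {A : Type*} [TopologicalSpace A] {d : A → ι → ℂ}
    (hd : ∀ a i, ‖d a i‖ ≤ 1) (hc : ∀ i, Continuous fun a => d a i) :
    Continuous fun a =>
      (ContinuousLinearMapWOT.ofCLM (b.diagonal (d a) (hd a)) : H →WOT[ℂ] H) := by
  refine ContinuousLinearMapWOT.continuous_of_dual_apply_continuous fun x y => ?_
  obtain ⟨w, rfl⟩ := (InnerProductSpace.toDual ℂ H).surjective y
  have heq : ∀ a, (InnerProductSpace.toDual ℂ H w) ((ContinuousLinearMapWOT.ofCLM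
      (b.diagonal (d a) (hd a)) : H →WOT[ℂ] H) x) =
      ∑' i, d a i * b.repr x i * star (b.repr w i) := fun a => by
    rw [InnerProductSpace.toDual_apply_apply, ← b.repr.inner_map_map, lp.inner_eq_tsum]
    refine tsum_congr fun i => ?_
    simp [RCLike.inner_apply]
  simp only [heq]
  have hs : ∀ u : lp (fun _ : ι => ℂ) 2, Summable fun i => ‖u i‖ ^ 2 := fun u => by
    simpa using (lp.memℓp u).summable (by norm_num)
  refine continuous_tsum (fun i => ((hc i).mul continuous_const).mul continuous_const)
    ((hs (b.repr x)).add (hs (b.repr w))) fun i a => ?_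
  rw [norm_mul, norm_mul, norm_star]
  have h1 : ‖d a i‖ * ‖b.repr x i‖ ≤ ‖b.repr x i‖ :=
    mul_le_of_le_one_left (norm_nonneg _) (hd a i)
  nlinarith [mul_le_mul_of_nonneg_right h1 (norm_nonneg (b.repr w i)),
    sq_nonneg (‖b.repr x i‖ - ‖b.repr w i‖), sq_nonneg ‖b.repr x i‖, sq_nonneg ‖b.repr w i‖]

end Diagonal

/-! ### Unitary equivalence is not reducible to actions of CLI groups -/

/-- Both classes of operators are handled at once: all that matters is that a space `A` of operators
receives, by a Borel map, the diagonal operators with entries `φ (z i)` for `z : ℕ → ℝ`, where `φ` is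
injective. -/
theorem not_borelReducible_comap_unitaryEquivalence
    {H : Type*} [NormedAddCommGroup H] [InnerProductSpace ℂ H] [CompleteSpace H]
    {G : Type*} [Group G] [TopologicalSpace G] [IsCLIGroup G] [MeasurableSpace G] [BorelSpace G]
    {Y : Type*} [MeasurableSpace Y] [StandardBorelSpace Y] [MulAction G Y] [MeasurableSMul₂ G Y]
    {A : Type*} [MeasurableSpace A] (toCLM : A → H →L[ℂ] H) (b : HilbertBasis ℕ ℂ H)
    {φ : ℝ → ℂ} (hφ : ∀ t, ‖φ t‖ ≤ 1) (hinj : Function.Injective φ) {T : (ℕ → ℝ) → A}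
    (hT : Measurable T) (hTφ : ∀ z, toCLM (T z) = b.diagonal (fun i => φ (z i)) fun i => hφ (z i)) :
    ¬ BorelReducible ((unitaryEquivalence H).comap toCLM) (MulAction.orbitRel G Y) := by
  rintro ⟨f, hf, hfE⟩
  have hred : ∀ z z' : ℕ → ℝ, unitaryEquivalence H (b.diagonal (fun i => φ (z i)) fun i => hφ (z i))
      (b.diagonal (fun i => φ (z' i)) fun i => hφ (z' i)) ↔ ∃ g : G, f (T z) = g • f (T z') := by
    intro z z'
    rw [← hTφ, ← hTφ]
    exact (hfE (T z) (T z')).trans (by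
      rw [MulAction.orbitRel_apply, MulAction.mem_orbit_iff]
      simp only [eq_comm])
  obtain ⟨x, z, hne, hg⟩ := exists_range_ne_of_forall_perm (G := G) (hf.comp hT) fun v z =>
    (hred (z ∘ v) z).1 ((unitaryEquivalence H).symm (b.unitaryEquivalence_diagonal_comp _ v))
  have hr := b.range_eq_of_unitaryEquivalence _ _ ((hred x z).2 hg)
  change range (φ ∘ x) = range (φ ∘ z) at hr
  rw [range_comp, range_comp] at hr
  exact hne (hinj.image_injective hr)

theorem mainTheorem4
    (H : Type*) [NormedAddCommGroup H] [InnerProductSpace ℂ H] [CompleteSpace H]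
    [TopologicalSpace.SeparableSpace H] (hH : ¬ FiniteDimensional ℂ H)
    (G : Type*) [Group G] [TopologicalSpace G] [IsCLIGroup G]
    [MeasurableSpace G] [BorelSpace G]
    (Y : Type*) [MeasurableSpace Y] [StandardBorelSpace Y]
    [MulAction G Y] [MeasurableSMul₂ G Y] :
    ¬ BorelReducible (unitaryEquivalenceOfUnitary H) (MulAction.orbitRel G Y) ∧
    ¬ BorelReducible (unitaryEquivalenceOfSelfAdjoint H) (MulAction.orbitRel G Y) := by
  obtain ⟨b⟩ := nonempty_hilbertBasis_nat hH
  constructor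
  · let φ : ℝ → ℂ := fun t => Circle.exp (Real.arctan t)
    have hφ1 : ∀ t, ‖φ t‖ = 1 := fun t => Circle.norm_coe _
    have hφ : ∀ t, ‖φ t‖ ≤ 1 := fun t => (hφ1 t).le
    have hc : Continuous φ := by fun_prop
    have hinj : Function.Injective φ := fun s t h => by
      have hIoc : ∀ t, Real.arctan t ∈ Ioc (-Real.pi) Real.pi := fun t =>
        ⟨by linarith [Real.neg_pi_div_two_lt_arctan t, Real.pi_pos],
          by linarith [Real.arctan_lt_pi_div_two t, Real.pi_pos]⟩
      exact Real.arctan_injective (by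
        rw [← Circle.arg_exp (hIoc s).1 (hIoc s).2, ← Circle.arg_exp (hIoc t).1 (hIoc t).2]
        exact congrArg Complex.arg h)
    let T : (ℕ → ℝ) → UnitaryOperator H := fun z =>
      ⟨b.diagonal (fun i => φ (z i)) fun i => hφ (z i), b.diagonal_mem_unitary _ fun i => hφ1 (z i)⟩
    have hT : Continuous T := by
      refine continuous_induced_rng.2 ?_
      exact b.continuous_diagonal (d := fun (z : ℕ → ℝ) i => φ (z i)) (fun z i => hφ (z i))
        fun i => hc.comp (continuous_apply i)
    exact not_borelReducible_comap_unitaryEquivalence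
      UnitaryOperator.toCLM b hφ hinj hT.measurable fun z => rfl
  · let φ : ℝ → ℂ := fun t => (Real.sin (Real.arctan t) : ℝ)
    have hφ : ∀ t, ‖φ t‖ ≤ 1 := fun t => by
      rw [Complex.norm_real]
      exact Real.abs_sin_le_one _
    have hc : Continuous φ := by fun_prop
    have hinj : Function.Injective φ := fun s t h => by
      have hIcc : ∀ t, Real.arctan t ∈ Icc (-(Real.pi / 2)) (Real.pi / 2) := fun t =>
        ⟨(Real.neg_pi_div_two_lt_arctan t).le, (Real.arctan_lt_pi_div_two t).le⟩
      exact Real.arctan_injective (Real.injOn_sin (hIcc s) (hIcc t) (Complex.ofReal_injective h))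
    let T : (ℕ → ℝ) → SelfAdjointOperator H := fun z =>
      ⟨b.diagonal (fun i => φ (z i)) fun i => hφ (z i),
        b.isSelfAdjoint_diagonal _ fun i => Complex.conj_ofReal _⟩
    have hT : Continuous T := by
      refine continuous_induced_rng.2 ?_
      exact b.continuous_diagonal (d := fun (z : ℕ → ℝ) i => φ (z i)) (fun z i => hφ (z i))
        fun i => hc.comp (continuous_apply i)
    exact not_borelReducible_comap_unitaryEquivalence
      SelfAdjointOperator.toCLM b hφ hinj hT.measurable fun z => rfl
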